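/- A planar convex body is a compact convex subset $K$ of the Euclidean plane $\mathbb R^2$ with non-empty interior. Let $\omega(K)$ be its minimal width (the minimal distance between two parallel supporting lines of $K$), let $r(K)$ be its inradius (the radius of a largest disk contained in $K$), and let $d_{\mathcal H}$ denote the Hausdorff distance. Put $$\alpha_E(K):=\min\left\{\frac{d_{\mathcal H}(K,E)}{\omega(E)}\ :\ E \text{ an equilateral triangle},\ \omega(E)=\omega(K)\right\},\qquad \beta_E(K):=\min\left\{\alpha_E(K),\tfrac16\right\}.$$ There exists a constant $c_4>0$ such that every planar convex body $K$ satisfies $$\frac{r(K)}{\omega(K)}-\frac13\ \ge\ c_4\,\beta_E(K),$$ and one can take $c_4=\tfrac1{25}$. -/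

import Mathlib

/-- The Euclidean plane. -/
abbrev Plane : Type := EuclideanSpace ℝ (Fin 2)

/-- The width of `K` in the direction `u`: for a unit vector `u` and a nonempty compact set `K`,
the distance between the two supporting lines of `K` orthogonal to `u`, that is, the length of the
orthogonal projection of `K` onto a line parallel to `u`. -/
noncomputable def dirWidth (K : Set Plane) (u : Plane) : ℝ :=
  sSup ((fun x => inner ℝ u x) '' K) - sInf ((fun x => inner ℝ u x) '' K)

/-- The minimal width `ω(K)`: the minimum over all directions of the directional width. -/
noncomputable def minWidth (K : Set Plane) : ℝ :=
  sInf {w : ℝ | ∃ u : Plane, ‖u‖ = 1 ∧ w = dirWidth K u}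

/-- The inradius `r(K)`: the largest radius of a disk contained in `K`. -/
noncomputable def inradius (K : Set Plane) : ℝ :=
  sSup {ρ : ℝ | 0 ≤ ρ ∧ ∃ x : Plane, Metric.closedBall x ρ ⊆ K}

/-- `E` is a (filled, nondegenerate) equilateral triangle. -/
def IsEquilateralTriangle (E : Set Plane) : Prop :=
  ∃ T : Affine.Triangle ℝ Plane, T.Equilateral ∧ E = convexHull ℝ (Set.range T.points)

/-- The Hausdorff asymmetry `α_E(K)`: the minimum of `d_H(K, E) / ω(E)` over the equilateral
triangles `E` with `ω(E) = ω(K)`. -/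
noncomputable def alphaE (K : Set Plane) : ℝ :=
  sInf {a : ℝ | ∃ E : Set Plane, IsEquilateralTriangle E ∧ minWidth E = minWidth K ∧
    a = Metric.hausdorffDist K E / minWidth E}

/-- The truncated asymmetry `β_E(K) = min {α_E(K), 1/6}`. -/
noncomputable def betaE (K : Set Plane) : ℝ := min (alphaE K) (1 / 6)

/-! Write `w` for the width, `r` for the inradius and `d = r/w - 1/3`. If `d ≥ 1/150`, truncation of
`betaE` at `1/6` settles the claim, so let `d ≤ 1/150`.

Since an incircle cannot be moved and enlarged, `0` is a convex combination `∑ lᵢ uᵢ` of three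
normals at which it touches supporting lines of `K` (`zero_mem_convexHull_contactNormals`). The
depths below these lines satisfy `∑ lᵢ (r - ⟪uᵢ, x - c⟫) = r` at every `x`. Some point of `K` has
depth at least `w` below the `i`-th line, so `lᵢ ≤ r/w = 1/3 + d` (`weight_mul_le`). As the weights
sum to 1, `d ≥ 0` and `lᵢ ≥ 1/3 - 2d`.

The vectors `lᵢ uᵢ` thus close up to a nearly equilateral triangle, so the three supporting lines
bound a nearly regular one. Matching barycentric coordinates with a regular triangle of width `w`
moves points of `K` by at most `14.4 d w` (`displacement_sq_le`, `dist_sum_regularVertices_le`), and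
the deep points land within `10.4 d w` of the vertices. Together these give `alphaE K ≤ 25 d`
(`alphaE_le_of_contactNormals`). -/

/-! ### Orthonormal frames and directional widths -/

/-- Of the two quarter turns of `u`, the one on the side of `v` is chosen; this sign later makes the
height `m` of the polygon of normals nonnegative. -/
theorem exists_isometric_frame {u v : Plane} (hu : ‖u‖ = 1) :
    ∃ e : Plane, 0 ≤ inner ℝ e v ∧ inner ℝ u e = 0 ∧ ‖e‖ = 1 ∧
      ∀ x y : Plane, inner ℝ x y = inner ℝ u x * inner ℝ u y + inner ℝ e x * inner ℝ e y := by
  have hu2 : u 0 ^ 2 + u 1 ^ 2 = 1 := by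
    have := EuclideanSpace.real_norm_sq_eq u
    rw [hu, Fin.sum_univ_two] at this
    linarith
  have key : ∀ s : ℝ, s ^ 2 = 1 → 0 ≤ inner ℝ (!₂[-(s * u 1), s * u 0] : Plane) v →
      ∃ e : Plane, 0 ≤ inner ℝ e v ∧ inner ℝ u e = 0 ∧ ‖e‖ = 1 ∧
      ∀ x y : Plane, inner ℝ x y = inner ℝ u x * inner ℝ u y + inner ℝ e x * inner ℝ e y := by
    intro s hs h0
    refine ⟨_, h0, ?_, ?_, ?_⟩
    · simp [PiLp.inner_apply, Fin.sum_univ_two]; ring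
    · have := EuclideanSpace.real_norm_sq_eq (!₂[-(s * u 1), s * u 0] : Plane)
      rw [Fin.sum_univ_two] at this
      have h2 : ‖(!₂[-(s * u 1), s * u 0] : Plane)‖ ^ 2 = 1 := by
        rw [this]; simp
        linear_combination s ^ 2 * hu2 + hs
      exact (pow_eq_one_iff_of_nonneg (norm_nonneg _) two_ne_zero).1 h2
    · intro x y
      simp [PiLp.inner_apply, Fin.sum_univ_two]
      linear_combination (-(x 0 * y 0 + x 1 * y 1)) * hu2
        - (x 0 * u 1 - x 1 * u 0) * (y 0 * u 1 - y 1 * u 0) * hs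
  rcases le_total 0 (inner ℝ (!₂[-(1 * u 1), 1 * u 0] : Plane) v) with h | h
  · exact key 1 (by norm_num) h
  · refine key (-1) (by norm_num) ?_
    simp [PiLp.inner_apply, Fin.sum_univ_two] at h ⊢
    linarith

theorem norm_sq_eq_of_frame {u e : Plane}
    (h : ∀ x y : Plane, inner ℝ x y = inner ℝ u x * inner ℝ u y + inner ℝ e x * inner ℝ e y)
    (x : Plane) : ‖x‖ ^ 2 = inner ℝ u x ^ 2 + inner ℝ e x ^ 2 := by
  rw [← real_inner_self_eq_norm_sq, h x x]; ring

theorem bddAbove_inner_image {A : Set Plane} (hA : IsCompact A) (z : Plane) :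
    BddAbove ((fun x => inner ℝ z x) '' A) :=
  (hA.image (by fun_prop)).bddAbove

theorem bddBelow_inner_image {A : Set Plane} (hA : IsCompact A) (z : Plane) :
    BddBelow ((fun x => inner ℝ z x) '' A) :=
  (hA.image (by fun_prop)).bddBelow

theorem inner_sub_le_dirWidth {A : Set Plane} (hA : IsCompact A) (z : Plane) {x y : Plane}
    (hx : x ∈ A) (hy : y ∈ A) : inner ℝ z (x - y) ≤ dirWidth A z := by
  have h1 := le_csSup (bddAbove_inner_image hA z) (Set.mem_image_of_mem _ hx)
  have h2 := csInf_le (bddBelow_inner_image hA z) (Set.mem_image_of_mem _ hy)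
  rw [inner_sub_right]
  unfold dirWidth
  linarith

theorem dirWidth_le_of_mem {A : Set Plane} (hA : A.Nonempty) {z : Plane} {a b : ℝ}
    (h : ∀ x ∈ A, inner ℝ z x ∈ Set.Icc a b) : dirWidth A z ≤ b - a := by
  have h1 : sSup ((fun x => inner ℝ z x) '' A) ≤ b :=
    csSup_le (hA.image _) (by rintro _ ⟨x, hx, rfl⟩; exact (h x hx).2)
  have h2 : a ≤ sInf ((fun x => inner ℝ z x) '' A) :=
    le_csInf (hA.image _) (by rintro _ ⟨x, hx, rfl⟩; exact (h x hx).1)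
  unfold dirWidth
  linarith

theorem minWidth_le_dirWidth {A : Set Plane} (hA : IsCompact A) (hne : A.Nonempty) {z : Plane}
    (hz : ‖z‖ = 1) : minWidth A ≤ dirWidth A z := by
  refine csInf_le ⟨0, ?_⟩ ⟨z, hz, rfl⟩
  rintro _ ⟨v, -, rfl⟩
  obtain ⟨x, hx⟩ := hne
  simpa using inner_sub_le_dirWidth hA v hx hx

theorem le_minWidth {A : Set Plane} {b : ℝ} (h : ∀ z : Plane, ‖z‖ = 1 → b ≤ dirWidth A z) :
    b ≤ minWidth A := by
  refine le_csInf ⟨_, EuclideanSpace.single 0 1, by simp, rfl⟩ ?_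
  rintro _ ⟨v, hv, rfl⟩
  exact h v hv

theorem two_mul_le_minWidth {A : Set Plane} (hA : IsCompact A) {x : Plane} {ρ : ℝ} (hρ : 0 ≤ ρ)
    (h : Metric.closedBall x ρ ⊆ A) : 2 * ρ ≤ minWidth A := by
  refine le_minWidth fun z hz => ?_
  have h1 : x + ρ • z ∈ A := h (by simp [norm_smul, hz, abs_of_nonneg hρ])
  have h2 : x - ρ • z ∈ A := h (by simp [norm_smul, hz, abs_of_nonneg hρ])
  have := inner_sub_le_dirWidth hA z h1 h2
  have e : inner ℝ z (x + ρ • z - (x - ρ • z)) = 2 * ρ := by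
    simp [inner_add_right, inner_smul_right, hz]; ring
  linarith

/-- A supporting half-plane of `A` has a point of `A` at depth at least the minimal width. -/
theorem exists_mem_inner_le_sub_minWidth {A : Set Plane} (hA : IsCompact A) (hne : A.Nonempty)
    {z c : Plane} {r : ℝ} (hz : ‖z‖ = 1) (h : ∀ x ∈ A, inner ℝ z (x - c) ≤ r) :
    ∃ x ∈ A, inner ℝ z (x - c) ≤ r - minWidth A := by
  obtain ⟨p, hp, hmin⟩ := hA.exists_isMinOn (f := fun x => inner ℝ z x) hne (by fun_prop)
  refine ⟨p, hp, ?_⟩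
  have h1 := minWidth_le_dirWidth hA hne hz
  have h2 : dirWidth A z ≤ (r + inner ℝ z c) - inner ℝ z p := by
    refine dirWidth_le_of_mem hne fun x hx => ⟨hmin hx, ?_⟩
    have := h x hx
    rw [inner_sub_right] at this
    linarith
  rw [inner_sub_right]
  linarith

/-! ### Estimates for nearly equal weights -/

section NearlyRegularWeights

variable {d l₁ l₂ l₃ : ℝ}

/-- The minimum over the admissible weights is at a corner `(1/3 + d, 1/3 + d, 1/3 - 2d)`, where the
product is `1/27 - 4d² + 16d³`. -/
theorem le_prod_one_sub_two_mul (hd : 0 ≤ d) (hd' : d ≤ 1 / 150) (h₁ : l₁ ≤ 1 / 3 + d)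
    (h₂ : l₂ ≤ 1 / 3 + d) (h₃ : l₃ ≤ 1 / 3 + d) (hs : l₁ + l₂ + l₃ = 1) :
    1 / 27 - 4 * d ^ 2 ≤ (1 - 2 * l₁) * (1 - 2 * l₂) * (1 - 2 * l₃) := by
  obtain rfl : l₃ = 1 - l₁ - l₂ := by linarith
  obtain ⟨x, rfl⟩ : ∃ x, l₁ = 1 / 3 + d - x := ⟨1 / 3 + d - l₁, by ring⟩
  obtain ⟨y, rfl⟩ : ∃ y, l₂ = 1 / 3 + d - y := ⟨1 / 3 + d - l₂, by ring⟩
  have hx : 0 ≤ x := by linarith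
  have hy : 0 ≤ y := by linarith
  have hxy : x + y ≤ 3 * d := by linarith
  have h1 : (1 / 3 - 2 * d) * (1 / 3 - 2 * d) * (1 / 3 + 4 * d) ≤
      (1 / 3 - 2 * d + 2 * x) * (1 / 3 - 2 * d + 2 * y) *
        (1 / 3 - 2 * d + 2 * (3 * d - x - y)) := by
    have e1 : (1 / 3 - 2 * d) * ((x + y) * (3 * d - x - y) + x * y) ≥ 0 := by
      have := mul_nonneg hx hy
      have := mul_nonneg (add_nonneg hx hy) (by linarith : 0 ≤ 3 * d - x - y)
      exact mul_nonneg (by linarith) (by linarith)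
    have e2 : 0 ≤ x * y * (3 * d - x - y) :=
      mul_nonneg (mul_nonneg hx hy) (by linarith)
    nlinarith
  nlinarith [pow_nonneg hd 3]

/-- AM-GM for three nonnegative numbers with sum 1. -/
theorem prod_one_sub_two_mul_le (hd' : d ≤ 1 / 150) (h₁ : l₁ ≤ 1 / 3 + d)
    (h₂ : l₂ ≤ 1 / 3 + d) (h₃ : l₃ ≤ 1 / 3 + d) (hs : l₁ + l₂ + l₃ = 1) :
    (1 - 2 * l₁) * (1 - 2 * l₂) * (1 - 2 * l₃) ≤ 1 / 27 := by
  obtain ⟨x, hx⟩ : ∃ x, x = 1 - 2 * l₁ := ⟨_, rfl⟩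
  obtain ⟨y, hy⟩ : ∃ y, y = 1 - 2 * l₂ := ⟨_, rfl⟩
  obtain ⟨z, hz⟩ : ∃ z, z = 1 - 2 * l₃ := ⟨_, rfl⟩
  rw [← hx, ← hy, ← hz]
  have hx0 : 0 ≤ x := by linarith
  have hy0 : 0 ≤ y := by linarith
  obtain rfl : z = 1 - x - y := by linarith
  nlinarith [mul_nonneg hx0 (sq_nonneg (y - 1 / 3)), mul_nonneg hy0 (sq_nonneg (x - 1 / 3)),
    mul_nonneg (by linarith : 0 ≤ 1 - x - y) (sq_nonneg (x - y)), sq_nonneg (x - y),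
    sq_nonneg (x + y - 2 / 3), mul_nonneg (add_nonneg hx0 hy0) (sq_nonneg (x + y - 2 / 3))]

set_option maxHeartbeats 1600000 in
/-- If the unit normals of a triangle, in coordinates where the first one is `(1, 0)`, have nearly
equal weights `lᵢ` summing them to zero, then the affine map to the regular triangle which matches
barycentric coordinates `aᵢ` moves points by at most a multiple of the deviation. -/
theorem displacement_sq_le {p₂ q₂ p₃ q₃ ξ η a₁ a₂ a₃ c : ℝ} (hd : 0 ≤ d) (hd' : d ≤ 1 / 150)
    (h₁ : l₁ ≤ 1 / 3 + d) (h₂ : l₂ ≤ 1 / 3 + d) (h₃ : l₃ ≤ 1 / 3 + d) (hs : l₁ + l₂ + l₃ = 1)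
    (hn₂ : p₂ ^ 2 + q₂ ^ 2 = 1) (hn₃ : p₃ ^ 2 + q₃ ^ 2 = 1) (hp : l₁ + l₂ * p₂ + l₃ * p₃ = 0)
    (hq : l₂ * q₂ + l₃ * q₃ = 0) (hq₂ : 0 ≤ q₂)
    (e₁ : (1 / 3 + d) * a₁ = l₁ * (1 / 3 + d - ξ))
    (e₂ : (1 / 3 + d) * a₂ = l₂ * (1 / 3 + d - (p₂ * ξ + q₂ * η)))
    (e₃ : (1 / 3 + d) * a₃ = l₃ * (1 / 3 + d - (p₃ * ξ + q₃ * η)))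
    (ha₁ : 0 ≤ a₁) (ha₂ : 0 ≤ a₂) (ha₃ : 0 ≤ a₃) (ha : a₁ + a₂ + a₃ = 1)
    (hc : 0 ≤ c) (hc3 : 3 * c ^ 2 = 1) :
    (ξ - (1 / 3 - a₁)) ^ 2 + (η - c * (a₃ - a₂)) ^ 2 ≤ (14.4 * d) ^ 2 := by
  have g₁ : 1 / 3 - 2 * d ≤ l₁ := by linarith
  have g₂ : 1 / 3 - 2 * d ≤ l₂ := by linarith
  have g₃ : 1 / 3 - 2 * d ≤ l₃ := by linarith
  have l1pos : (0.32 : ℝ) ≤ l₁ := by linarith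
  have l1sq : (0.1024 : ℝ) ≤ l₁ ^ 2 := by
    calc (0.1024 : ℝ) = 0.32 ^ 2 := by norm_num
      _ ≤ _ := by gcongr
  -- first coordinate
  have hX : |ξ - (1 / 3 - a₁)| ≤ 9.375 * d := by
    have e : l₁ * (ξ - (1 / 3 - a₁)) = l₁ * d - a₁ * (1 / 3 + d - l₁) := by
      linear_combination e₁
    have b1 : 0 ≤ a₁ * (1 / 3 + d - l₁) := mul_nonneg ha₁ (by linarith)
    -- The gap `3d` comes from `l₁ ≥ 1/3 - 2d`; dividing by `l₁ ≥ 0.32` yields `9.375 = 3 / 0.32`.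
    have b2 : a₁ * (1 / 3 + d - l₁) ≤ 1 * (3 * d) := by gcongr <;> linarith
    have b3 : 0.32 * (9.375 * d) ≤ l₁ * (9.375 * d) := by gcongr
    have b4 : l₁ * d ≤ l₁ * (9.375 * d) := by gcongr; linarith
    rw [abs_le]
    constructor <;> refine le_of_mul_le_mul_left ?_ (by linarith : 0 < l₁) <;> linarith
  -- the height of the normal polygon
  obtain ⟨m, hm⟩ : ∃ m, m = 2 * (l₂ * q₂) := ⟨_, rfl⟩
  have hm0 : 0 ≤ m := by rw [hm]; have := mul_nonneg (by linarith : 0 ≤ l₂) hq₂; linarith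
  -- Law of cosines in the triangle with side vectors `lᵢ uᵢ`.
  have hdiff : 2 * l₁ * (l₂ * p₂) = l₃ ^ 2 - l₂ ^ 2 - l₁ ^ 2 := by
    have hp' : l₃ * p₃ = -l₁ - l₂ * p₂ := by linarith
    have hq' : l₃ * q₃ = -(l₂ * q₂) := by linarith
    have : (l₃ * p₃) ^ 2 + (l₃ * q₃) ^ 2 = l₃ ^ 2 := by linear_combination l₃ ^ 2 * hn₃
    rw [hp', hq'] at this
    linear_combination this - l₂ ^ 2 * hn₂
  -- Heron's formula for that triangle, of perimeter 1: `m * l₁` is four times its area.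
  have hprod : m ^ 2 * l₁ ^ 2 = (1 - 2 * l₁) * (1 - 2 * l₂) * (1 - 2 * l₃) := by
    have e : m ^ 2 * l₁ ^ 2 = 4 * l₁ ^ 2 * l₂ ^ 2 - (l₃ ^ 2 - l₂ ^ 2 - l₁ ^ 2) ^ 2 := by
      rw [hm, ← hdiff]; linear_combination 4 * l₁ ^ 2 * l₂ ^ 2 * hn₂
    rw [e]
    obtain rfl : l₃ = 1 - l₁ - l₂ := by linarith
    ring
  have lo := le_prod_one_sub_two_mul hd hd' h₁ h₂ h₃ hs
  have hi := prod_one_sub_two_mul_le hd' h₁ h₂ h₃ hs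
  rw [← hprod] at lo hi
  have l1sq' : l₁ ^ 2 ≤ 0.1156 := by
    calc l₁ ^ 2 ≤ 0.34 ^ 2 := by gcongr; linarith
      _ = _ := by norm_num
  have hmlo : (0.5645 : ℝ) ≤ m := by
    by_contra! hcon
    have : m ^ 2 ≤ 0.5645 ^ 2 := by gcongr
    have : m ^ 2 * l₁ ^ 2 ≤ 0.5645 ^ 2 * 0.1156 := by gcongr
    have : d ^ 2 ≤ (1 / 150) ^ 2 := by gcongr
    linarith
  -- the relative error of the height
  have hclo : (0.577 : ℝ) ≤ c := by
    by_contra! hcon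
    have : c ^ 2 ≤ 0.577 ^ 2 := by gcongr
    linarith
  have hcm : (0.325 : ℝ) ≤ c * m := by
    have : (0.577 : ℝ) * 0.5645 ≤ c * m := by gcongr
    linarith
  -- Multiplying by the conjugate sum turns the difference into one of squares, to which Heron's
  -- formula applies; `2.41` exceeds `0.162 / 0.0674`.
  have hρ : |(1 / 3 + d) - c * m| ≤ 2.41 * d := by
    have e : ((1 / 3 + d) - c * m) * (((1 / 3 + d) + c * m) * l₁ ^ 2) =
        (1 / 3 + d) ^ 2 * l₁ ^ 2 - m ^ 2 * l₁ ^ 2 / 3 := by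
      linear_combination -(m ^ 2 * l₁ ^ 2 / 3) * hc3
    have u1 : (1 / 3 + d) ^ 2 * l₁ ^ 2 ≤ (1 / 3 + d) ^ 2 * (1 / 3 + d) ^ 2 := by gcongr
    have u2 : (1 / 3) ^ 2 * (1 / 3 - 2 * d) ^ 2 ≤ (1 / 3 + d) ^ 2 * l₁ ^ 2 := by
      have : (0 : ℝ) ≤ 1 / 3 - 2 * d := by linarith
      gcongr
      linarith
    have d2 : d ^ 2 ≤ d * (1 / 150) := by rw [sq]; gcongr
    have d3 : d ^ 3 ≤ d * (1 / 150) ^ 2 := by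
      calc d ^ 3 = d * d ^ 2 := by ring
        _ ≤ _ := by gcongr
    have d4 : d ^ 4 ≤ d * (1 / 150) ^ 3 := by
      calc d ^ 4 = d * d ^ 3 := by ring
        _ ≤ _ := by gcongr
    have v1 : ((1 / 3 + d) - c * m) * (((1 / 3 + d) + c * m) * l₁ ^ 2) ≤ 0.162 * d := by
      rw [e]; linarith
    have v2 : -(0.162 * d) ≤ ((1 / 3 + d) - c * m) * (((1 / 3 + d) + c * m) * l₁ ^ 2) := by
      rw [e]; linarith
    have w : (0.0674 : ℝ) ≤ ((1 / 3 + d) + c * m) * l₁ ^ 2 := by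
      have : (0.6583 : ℝ) * 0.1024 ≤ ((1 / 3 + d) + c * m) * l₁ ^ 2 := by
        gcongr
        linarith
      linarith
    rw [abs_le]
    have b : 0.0674 * (2.41 * d) ≤ (((1 / 3 + d) + c * m) * l₁ ^ 2) * (2.41 * d) := by gcongr
    constructor <;> refine le_of_mul_le_mul_right ?_
      (by linarith : 0 < ((1 / 3 + d) + c * m) * l₁ ^ 2) <;> linarith
  -- second coordinate
  obtain ⟨G, hG⟩ : ∃ G, l₁ * G = l₁ * (1 / 3 + d) + (1 - l₁) * ξ :=
    ⟨(l₁ * (1 / 3 + d) + (1 - l₁) * ξ) / l₁, by field_simp⟩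
  have hGe : l₁ ^ 2 * G = (1 / 3 + d) * (l₁ - (1 - l₁) * a₁) := by
    linear_combination l₁ * hG + (1 - l₁) * e₁
  have hGb : |G| ≤ 1.196 := by
    have b1 : (1 - l₁) * a₁ ≤ (1 - l₁) * 1 := by
      apply mul_le_mul_of_nonneg_left <;> linarith
    have b2 : 0 ≤ (1 - l₁) * a₁ := mul_nonneg (by linarith) ha₁
    have b3 : |l₁ - (1 - l₁) * a₁| ≤ 0.36 := by
      rw [abs_le]; constructor <;> linarith
    have b4 : l₁ ^ 2 * |G| ≤ 0.34 * 0.36 := by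
      rw [← abs_of_nonneg (sq_nonneg l₁), ← abs_mul, hGe, abs_mul,
        abs_of_nonneg (by linarith : (0 : ℝ) ≤ 1 / 3 + d)]
      gcongr
      linarith
    by_contra! hcon
    have : (0.1024 : ℝ) * 1.196 ≤ l₁ ^ 2 * |G| := by gcongr
    linarith
  -- The difference of `e₂` and `e₃` splits the error into the asymmetry `l₂ - l₃` and the height
  -- error, both of order `d`.
  have hη : m * (η - c * (a₃ - a₂)) = (l₂ - l₃) * G + (a₃ - a₂) * ((1 / 3 + d) - c * m) := by
    have hl : l₁ ≠ 0 := by linarith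
    apply mul_left_cancel₀ hl
    have h5 : m * η = (l₂ - l₃) * (1 / 3 + d) + (1 / 3 + d) * (a₃ - a₂)
        - (l₂ * p₂ - l₃ * p₃) * ξ := by
      linear_combination η * hm + e₂ - e₃ + η * hq
    have h6 : l₁ * (l₂ * p₂ - l₃ * p₃) = -(l₂ - l₃) * (1 - l₁) := by
      have : l₂ + l₃ = 1 - l₁ := by linarith
      rw [← this]
      linear_combination hdiff - l₁ * hp
    linear_combination l₁ * h5 - ξ * h6 - (l₂ - l₃) * hG
  have hY : |η - c * (a₃ - a₂)| ≤ 10.64 * d := by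
    have b1 : |(l₂ - l₃) * G| ≤ 3 * d * 1.196 := by
      rw [abs_mul]; gcongr
      rw [abs_le]; constructor <;> linarith
    have b2 : |(a₃ - a₂) * ((1 / 3 + d) - c * m)| ≤ 1 * (2.41 * d) := by
      rw [abs_mul]; gcongr
      rw [abs_le]; constructor <;> linarith
    have b3 : |m * (η - c * (a₃ - a₂))| ≤ 3 * d * 1.196 + 1 * (2.41 * d) := by
      rw [hη]; exact (abs_add_le _ _).trans (add_le_add b1 b2)
    rw [abs_mul, abs_of_nonneg hm0] at b3
    by_contra! hcon
    have : (0.5645 : ℝ) * |η - c * (a₃ - a₂)| ≤ m * |η - c * (a₃ - a₂)| := by gcongr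
    linarith
  -- Here `9.375² + 10.64² < 14.4²`.
  have sX := sq_le_sq' (neg_le_of_abs_le hX) (le_of_abs_le hX)
  have sY := sq_le_sq' (neg_le_of_abs_le hY) (le_of_abs_le hY)
  linarith [sq_nonneg d]

end NearlyRegularWeights

/-! ### Incircles and their contact normals -/

open Filter Topology

/-- An incentre is a point of `A` farthest from the complement. -/
theorem exists_closedBall_inradius_subset {A : Set Plane} (hA : IsCompact A)
    (hi : (interior A).Nonempty) :
    0 < inradius A ∧ (∃ c, Metric.closedBall c (inradius A) ⊆ A) ∧
      ∀ x ρ, 0 ≤ ρ → Metric.closedBall x ρ ⊆ A → ρ ≤ inradius A := by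
  have hne : A.Nonempty := hi.mono interior_subset
  obtain ⟨c, hc, hmax⟩ := hA.exists_isMaxOn (f := fun x => Metric.infDist x Aᶜ) hne
    (Metric.continuous_infDist_pt _).continuousOn
  have hcne : (Aᶜ).Nonempty := by
    rw [Set.nonempty_compl]
    exact hA.ne_univ
  have hle : ∀ x ρ, 0 ≤ ρ → Metric.closedBall x ρ ⊆ A → ρ ≤ Metric.infDist c Aᶜ := by
    intro x ρ hρ h
    refine le_trans ?_ (hmax (h (Metric.mem_closedBall_self hρ)))
    refine (Metric.le_infDist hcne).2 fun y hy => ?_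
    by_contra! hcon
    exact hy (h (Metric.mem_closedBall'.2 hcon.le))
  obtain ⟨y, hy⟩ := hi
  obtain ⟨ε, hε, hball⟩ := Metric.nhds_basis_closedBall.mem_iff.1 (mem_interior_iff_mem_nhds.1 hy)
  have hpos : 0 < Metric.infDist c Aᶜ := hε.trans_le (hle y ε hε.le hball)
  have hsub : Metric.closedBall c (Metric.infDist c Aᶜ) ⊆ A := by
    rw [← closure_ball c hpos.ne']
    exact hA.isClosed.closure_subset_iff.2 Metric.ball_infDist_compl_subset
  have heq : inradius A = Metric.infDist c Aᶜ :=
    IsGreatest.csSup_eq ⟨⟨hpos.le, c, hsub⟩, by rintro ρ ⟨h0, x, hx⟩; exact hle x ρ h0 hx⟩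
  rw [heq]
  exact ⟨hpos, ⟨c, hsub⟩, hle⟩

theorem exists_unit_inner_lt {A : Set Plane} (hA : IsClosed A) (hconv : Convex ℝ A)
    (hne : A.Nonempty) {y : Plane} (hy : y ∉ A) :
    ∃ u : Plane, ‖u‖ = 1 ∧ ∀ x ∈ A, inner ℝ u x < inner ℝ u y := by
  obtain ⟨f, s, hf, hs⟩ := geometric_hahn_banach_closed_point hconv hA hy
  obtain ⟨v, rfl⟩ := (InnerProductSpace.toDual ℝ Plane).surjective f
  simp only [InnerProductSpace.toDual_apply_apply] at hf hs
  have hv : v ≠ 0 := by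
    rintro rfl
    obtain ⟨x, hx⟩ := hne
    have := hf x hx
    simp only [inner_zero_left] at this hs
    linarith
  refine ⟨(‖v‖⁻¹ : ℝ) • v, norm_smul_inv_norm hv, fun x hx => ?_⟩
  rw [real_inner_smul_left, real_inner_smul_left]
  have : 0 < ‖v‖⁻¹ := inv_pos.2 (norm_pos_iff.2 hv)
  exact mul_lt_mul_of_pos_left ((hf x hx).trans hs) this

/-- The outer unit normals of the supporting lines of `A` tangent to the disk `(c, r)`, when that
disk lies in `A`. -/
def contactNormals (A : Set Plane) (c : Plane) (r : ℝ) : Set Plane :=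
  {u | ‖u‖ = 1 ∧ ∀ x ∈ A, inner ℝ u (x - c) ≤ r}

theorem isCompact_contactNormals (A : Set Plane) (c : Plane) (r : ℝ) :
    IsCompact (contactNormals A c r) := by
  have : contactNormals A c r =
      Metric.sphere 0 1 ∩ ⋂ x ∈ A, {u | inner ℝ u (x - c) ≤ r} := by
    ext u; simp [contactNormals]
  rw [this]
  refine (isCompact_sphere _ _).inter_right (isClosed_biInter fun x _ => ?_)
  exact isClosed_le (by fun_prop) continuous_const

/-- By maximality the disk shifted by `t • v` and enlarged by `t²` leaves `A`, so a line separates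
one of its points from `A`. A limit of the normals as `t → 0` is the required contact normal; the
enlargement is of second order so that it disappears after division by `t`. -/
theorem exists_contactNormal_inner_nonneg {A : Set Plane} (hA : IsCompact A)
    (hconv : Convex ℝ A) {c : Plane} {r : ℝ} (hr : 0 < r) (hsub : Metric.closedBall c r ⊆ A)
    (hmax : ∀ x ρ, 0 ≤ ρ → Metric.closedBall x ρ ⊆ A → ρ ≤ r) (v : Plane) :
    ∃ u ∈ contactNormals A c r, 0 ≤ inner ℝ u v := by
  have hne : A.Nonempty := ⟨c, hsub (Metric.mem_closedBall_self hr.le)⟩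
  have step : ∀ n : ℕ, ∃ u : Plane, ‖u‖ = 1 ∧ ∀ x ∈ A,
      inner ℝ u (x - c) ≤ (1 / ((n : ℝ) + 1)) * inner ℝ u v + (r + (1 / ((n : ℝ) + 1)) ^ 2) := by
    intro n
    set t : ℝ := 1 / ((n : ℝ) + 1)
    have ht : 0 < t := by positivity
    have hnot : ¬ Metric.closedBall (c + t • v) (r + t ^ 2) ⊆ A := fun h => by
      have := hmax _ _ (by positivity) h
      nlinarith
    obtain ⟨y, hy, hyA⟩ := Set.not_subset.1 hnot
    obtain ⟨u, hu, hlt⟩ := exists_unit_inner_lt hA.isClosed hconv hne hyA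
    refine ⟨u, hu, fun x hx => ?_⟩
    have h1 := hlt x hx
    have h2 : inner ℝ u (y - (c + t • v)) ≤ r + t ^ 2 := by
      refine (real_inner_le_norm _ _).trans ?_
      rw [hu, one_mul, ← dist_eq_norm]
      exact hy
    simp only [inner_sub_right, inner_add_right, real_inner_smul_right] at h2 ⊢
    linarith
  choose u hu hub using step
  obtain ⟨w, hw, φ, hφ, hlim⟩ := (isCompact_sphere (0 : Plane) 1).tendsto_subseq
    (x := u) (fun n => by simp [hu n])
  have ht : Tendsto (fun n => 1 / ((φ n : ℝ) + 1)) atTop (𝓝 0) :=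
    tendsto_one_div_add_atTop_nhds_zero_nat.comp hφ.tendsto_atTop
  have hin : ∀ x : Plane, Tendsto (fun n => inner ℝ (u (φ n)) x) atTop (𝓝 (inner ℝ w x)) :=
    fun x => hlim.inner tendsto_const_nhds
  refine ⟨w, ⟨by simpa using hw, fun x hx => ?_⟩, ?_⟩
  · have h1 := (ht.mul (hin v)).add ((ht.pow 2).const_add r)
    have := le_of_tendsto_of_tendsto' (hin (x - c)) h1 fun n => hub (φ n) x hx
    simpa using this
  · have h1 : Tendsto (fun n => -(1 / ((φ n : ℝ) + 1))) atTop (𝓝 0) := by simpa using ht.neg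
    refine le_of_tendsto_of_tendsto' h1 (hin v) fun n => ?_
    -- Testing the separation at this point of the original disk gives `⟪u, v⟫ ≥ -t`.
    have hmem : c + r • u (φ n) ∈ A := hsub (by simp [norm_smul, hu, abs_of_pos hr])
    have h2 := hub (φ n) _ hmem
    have ht : 0 < 1 / ((φ n : ℝ) + 1) := by positivity
    set t := 1 / ((φ n : ℝ) + 1)
    rw [add_sub_cancel_left, real_inner_smul_right, real_inner_self_eq_norm_sq, hu] at h2
    nlinarith

/-- Carathéodory's theorem in the plane; shorter combinations are padded by repeating a point with
weight 0. -/
theorem exists_three_of_mem_convexHull {s : Set Plane} {x : Plane} (hx : x ∈ convexHull ℝ s) :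
    ∃ u₁ ∈ s, ∃ u₂ ∈ s, ∃ u₃ ∈ s, ∃ l₁ l₂ l₃ : ℝ, 0 ≤ l₁ ∧ 0 ≤ l₂ ∧ 0 ≤ l₃ ∧
      l₁ + l₂ + l₃ = 1 ∧ l₁ • u₁ + l₂ • u₂ + l₃ • u₃ = x := by
  obtain ⟨ι, _, z, w, hz, hind, hw, hsum, hcomb⟩ := eq_pos_convex_span_of_mem_convexHull hx
  have hcard : Fintype.card ι ≤ 3 := by
    have h1 := hind.card_le_finrank_succ
    have h2 := Submodule.finrank_le (vectorSpan ℝ (Set.range z))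
    rw [finrank_euclideanSpace_fin] at h2
    omega
  generalize hn : Fintype.card ι = n at hcard
  let e : Fin n ≃ ι := (Fintype.equivFinOfCardEq hn).symm
  rw [← e.sum_comp] at hsum hcomb
  have hm : ∀ i, z i ∈ s := fun i => hz ⟨i, rfl⟩
  interval_cases n
  · simp at hsum
  · refine ⟨_, hm (e 0), _, hm (e 0), _, hm (e 0), w (e 0), 0, 0, (hw _).le, le_rfl, le_rfl, ?_, ?_⟩
    · simpa using hsum
    · simpa using hcomb
  · refine ⟨_, hm (e 0), _, hm (e 1), _, hm (e 0), w (e 0), w (e 1), 0, (hw _).le, (hw _).le,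
      le_rfl, ?_, ?_⟩
    · simpa [Fin.sum_univ_two] using hsum
    · simpa [Fin.sum_univ_two] using hcomb
  · refine ⟨_, hm (e 0), _, hm (e 1), _, hm (e 2), w (e 0), w (e 1), w (e 2), (hw _).le, (hw _).le,
      (hw _).le, ?_, ?_⟩
    · simpa [Fin.sum_univ_three] using hsum
    · simpa [Fin.sum_univ_three] using hcomb

theorem isCompact_convexHull_plane {s : Set Plane} (hs : IsCompact s) :
    IsCompact (convexHull ℝ s) := by
  have : convexHull ℝ s = (fun p : (Plane × Plane × Plane) × (Fin 3 → ℝ) =>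
      p.2 0 • p.1.1 + p.2 1 • p.1.2.1 + p.2 2 • p.1.2.2) ''
      ((s ×ˢ s ×ˢ s) ×ˢ stdSimplex ℝ (Fin 3)) := by
    ext x
    constructor
    · intro hx
      obtain ⟨u₁, h₁, u₂, h₂, u₃, h₃, l₁, l₂, l₃, g₁, g₂, g₃, hl, rfl⟩ :=
        exists_three_of_mem_convexHull hx
      refine ⟨((u₁, u₂, u₃), ![l₁, l₂, l₃]), ⟨⟨h₁, h₂, h₃⟩, ?_, ?_⟩, by simp⟩
      · intro i; fin_cases i <;> simpa
      · simpa [Fin.sum_univ_three]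
    · rintro ⟨⟨⟨u₁, u₂, u₃⟩, l⟩, ⟨⟨h₁, h₂, h₃⟩, hl, hsum⟩, rfl⟩
      have h : ∀ u ∈ s, u ∈ convexHull ℝ s := subset_convexHull ℝ s
      rw [Fin.sum_univ_three] at hsum
      have := (convex_convexHull ℝ s).sum_mem (t := Finset.univ) (w := l) (z := ![u₁, u₂, u₃])
        (fun i _ => hl i) (by simpa [Fin.sum_univ_three])
        (fun i _ => by fin_cases i <;> [exact h _ h₁; exact h _ h₂; exact h _ h₃])
      simpa [Fin.sum_univ_three] using this
  rw [this]
  exact ((hs.prod (hs.prod hs)).prod (isCompact_stdSimplex ℝ (Fin 3))).image (by fun_prop)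

/-- Otherwise a direction `v` would have negative inner product with every contact normal, and the
disk could be moved along `v` and enlarged. -/
theorem zero_mem_convexHull_contactNormals {A : Set Plane} (hA : IsCompact A)
    (hconv : Convex ℝ A) {c : Plane} {r : ℝ} (hr : 0 < r) (hsub : Metric.closedBall c r ⊆ A)
    (hmax : ∀ x ρ, 0 ≤ ρ → Metric.closedBall x ρ ⊆ A → ρ ≤ r) :
    (0 : Plane) ∈ convexHull ℝ (contactNormals A c r) := by
  by_contra h0
  have hcomp : IsCompact (convexHull ℝ (contactNormals A c r)) :=
    isCompact_convexHull_plane (isCompact_contactNormals A c r)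
  obtain ⟨u₀, hu₀, -⟩ := exists_contactNormal_inner_nonneg hA hconv hr hsub hmax 0
  obtain ⟨v, -, hv⟩ := exists_unit_inner_lt hcomp.isClosed (convex_convexHull ℝ _)
    ⟨u₀, subset_convexHull ℝ _ hu₀⟩ h0
  obtain ⟨u, hu, hpos⟩ := exists_contactNormal_inner_nonneg hA hconv hr hsub hmax v
  have := hv u (subset_convexHull ℝ _ hu)
  rw [inner_zero_right, real_inner_comm] at this
  linarith

/-! ### The regular comparison triangle -/

/-- The vertices of the regular triangle with centre `c` and width `w` whose first side has outer
normal `u`; the unit vector `e` orthogonal to `u` spans the direction of that side. -/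
noncomputable def regularVertices (c u e : Plane) (w : ℝ) : Fin 3 → Plane :=
  ![c - (2 / 3 * w) • u, c + (1 / 3 * w) • u - (w * (√3)⁻¹) • e,
    c + (1 / 3 * w) • u + (w * (√3)⁻¹) • e]

theorem three_mul_inv_sqrt_three_sq : 3 * ((√3)⁻¹ : ℝ) ^ 2 = 1 := by
  rw [inv_pow, Real.sq_sqrt (by norm_num)]; norm_num

/-- The three bounded quantities are the projected sides of a regular triangle. If `|p| ≤ |q|` the
first suffices; otherwise `(|p| + |q|)² ≥ p² + 3q²`. -/
theorem sq_add_three_mul_sq_le {p q D : ℝ} (h₁ : |2 * q| ≤ D) (h₂ : |p - q| ≤ D)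
    (h₃ : |p + q| ≤ D) : p ^ 2 + 3 * q ^ 2 ≤ D ^ 2 := by
  have h₁ := sq_le_sq' (neg_le_of_abs_le h₁) (le_of_abs_le h₁)
  have h₂ := sq_le_sq' (neg_le_of_abs_le h₂) (le_of_abs_le h₂)
  have h₃ := sq_le_sq' (neg_le_of_abs_le h₃) (le_of_abs_le h₃)
  rcases le_total (p ^ 2) (q ^ 2) with h | h
  · linarith
  · have : q ^ 2 ≤ |p| * |q| := by
      rw [← sq_abs q, sq]
      exact mul_le_mul_of_nonneg_right (sq_le_sq.1 h) (abs_nonneg q)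
    rw [← abs_mul] at this
    rcases abs_cases (p * q) with ⟨h, -⟩ | ⟨h, -⟩ <;> rw [h] at this <;> linarith

section Frame

variable {c u e : Plane} {w : ℝ}

theorem inner_frame_combination (hu : ‖u‖ = 1) (he : ‖e‖ = 1) (hue : inner ℝ u e = 0) (x y : ℝ) :
    inner ℝ u (x • u + y • e) = x ∧ inner ℝ e (x • u + y • e) = y := by
  have heu : inner ℝ e u = 0 := by rw [real_inner_comm]; exact hue
  simp [inner_add_right, real_inner_smul_right, hue, heu, hu, he]

theorem norm_sq_frame_combination (hu : ‖u‖ = 1) (he : ‖e‖ = 1) (hue : inner ℝ u e = 0)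
    (x y : ℝ) : ‖x • u + y • e‖ ^ 2 = x ^ 2 + y ^ 2 := by
  obtain ⟨h1, h2⟩ := inner_frame_combination hu he hue x y
  rw [← real_inner_self_eq_norm_sq, inner_add_left, real_inner_smul_left, real_inner_smul_left,
    h1, h2]
  ring

theorem dist_regularVertices (hu : ‖u‖ = 1) (he : ‖e‖ = 1) (hue : inner ℝ u e = 0) (hw : 0 ≤ w)
    {i j : Fin 3} (hij : i ≠ j) :
    dist (regularVertices c u e w i) (regularVertices c u e w j) = 2 * w * (√3)⁻¹ := by
  have h3 := three_mul_inv_sqrt_three_sq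
  set k : ℝ := (√3)⁻¹ with hk
  have hk0 : 0 ≤ k := by positivity
  have key : ∀ x y : ℝ, x ^ 2 + y ^ 2 = (2 * w * k) ^ 2 → ∀ v : Plane, v = x • u + y • e →
      ‖v‖ = 2 * w * k := by
    rintro x y hxy _ rfl
    rw [← sq_eq_sq₀ (norm_nonneg _) (by positivity), norm_sq_frame_combination hu he hue, hxy]
  rw [dist_eq_norm]
  have e1 : w ^ 2 + (w * k) ^ 2 = (2 * w * k) ^ 2 := by linear_combination (-w ^ 2) * h3
  fin_cases i <;> fin_cases j <;> simp only [regularVertices, ← hk] at hij ⊢ <;>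
    first
    | exact absurd rfl hij
    | skip
  · refine key (-w) (w * k) (by linear_combination e1) _ ?_
    simp; module
  · refine key (-w) (-(w * k)) (by linear_combination e1) _ ?_
    simp; module
  · refine key w (-(w * k)) (by linear_combination e1) _ ?_
    simp; module
  · refine key 0 (-(2 * w * k)) (by ring) _ ?_
    simp; module
  · refine key w (w * k) (by linear_combination e1) _ ?_
    simp; module
  · refine key 0 (2 * w * k) (by ring) _ ?_
    simp; module

theorem affineIndependent_regularVertices (hu : ‖u‖ = 1) (he : ‖e‖ = 1) (hue : inner ℝ u e = 0)
    (hw : 0 < w) : AffineIndependent ℝ (regularVertices c u e w) := by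
  rw [affineIndependent_iff]
  intro s a ha hs
  have key : ∀ a : Fin 3 → ℝ, ∑ i, a i = 0 → ∑ i, a i • regularVertices c u e w i = 0 → a = 0 := by
    intro a ha hs
    rw [Fin.sum_univ_three] at ha hs
    have h : (w * (1 / 3 * (a 1 + a 2) - 2 / 3 * a 0)) • u +
        (w * (√3)⁻¹ * (a 2 - a 1)) • e = 0 := by
      rw [← hs]
      have e0 : a 0 = -a 1 - a 2 := by linarith
      simp only [regularVertices, e0]
      simp
      module
    have hk : (√3 : ℝ)⁻¹ ≠ 0 := by positivity
    obtain ⟨h1, h2⟩ := inner_frame_combination hu he hue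
      (w * (1 / 3 * (a 1 + a 2) - 2 / 3 * a 0)) (w * (√3)⁻¹ * (a 2 - a 1))
    rw [h, inner_zero_right] at h1 h2
    have h1' := (mul_eq_zero.1 h1.symm).resolve_left hw.ne'
    have h2' := (mul_eq_zero.1 h2.symm).resolve_left (mul_ne_zero hw.ne' hk)
    ext i
    fin_cases i <;> simp <;> linarith
  have h := key (fun i => if i ∈ s then a i else 0)
    (by simpa [Finset.sum_ite_mem] using ha) (by simpa [ite_smul, Finset.sum_ite_mem] using hs)
  intro i hi
  simpa [hi] using congrFun h i

theorem isEquilateralTriangle_regularVertices (hu : ‖u‖ = 1) (he : ‖e‖ = 1)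
    (hue : inner ℝ u e = 0) (hw : 0 < w) :
    IsEquilateralTriangle (convexHull ℝ (Set.range (regularVertices c u e w))) :=
  ⟨⟨_, affineIndependent_regularVertices hu he hue hw⟩,
    ⟨_, fun _ _ hij => dist_regularVertices hu he hue hw.le hij⟩, rfl⟩

theorem minWidth_regularVertices
    (hu : ‖u‖ = 1) (hue : inner ℝ u e = 0)
    (hf : ∀ x y : Plane, inner ℝ x y = inner ℝ u x * inner ℝ u y + inner ℝ e x * inner ℝ e y)
    (hw : 0 < w) :
    minWidth (convexHull ℝ (Set.range (regularVertices c u e w))) = w := by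
  have hcomp : IsCompact (convexHull ℝ (Set.range (regularVertices c u e w))) :=
    isCompact_convexHull_plane (Set.finite_range _).isCompact
  have hmem : ∀ i, regularVertices c u e w i ∈
      convexHull ℝ (Set.range (regularVertices c u e w)) :=
    fun i => subset_convexHull ℝ _ ⟨i, rfl⟩
  have hne : (convexHull ℝ (Set.range (regularVertices c u e w))).Nonempty := ⟨_, hmem 0⟩
  apply le_antisymm
  · refine (minWidth_le_dirWidth hcomp hne hu).trans ?_
    have : convexHull ℝ (Set.range (regularVertices c u e w)) ⊆
        {x | inner ℝ u x ∈ Set.Icc (inner ℝ u c - 2 / 3 * w) (inner ℝ u c + 1 / 3 * w)} := by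
      refine convexHull_min ?_ ?_
      · rintro _ ⟨i, rfl⟩
        fin_cases i <;>
          simp [regularVertices, inner_add_right, inner_sub_right, real_inner_smul_right, hu,
            hue] <;> linarith
      · exact (convex_Icc _ _).is_linear_preimage (f := fun x => inner ℝ u x)
          ⟨fun x y => inner_add_right _ _ _, fun a x => real_inner_smul_right _ _ _⟩
    refine (dirWidth_le_of_mem hne this).trans ?_
    linarith
  · refine le_minWidth fun z hz => ?_
    have hsub : ∀ i j, inner ℝ z (regularVertices c u e w i) -
        inner ℝ z (regularVertices c u e w j) ≤
          dirWidth (convexHull ℝ (Set.range (regularVertices c u e w))) z := fun i j => by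
      rw [← inner_sub_right]
      exact inner_sub_le_dirWidth hcomp z (hmem i) (hmem j)
    generalize dirWidth (convexHull ℝ (Set.range (regularVertices c u e w))) z = D at hsub
    have hz2 := norm_sq_eq_of_frame hf z
    rw [hz] at hz2
    have h3 := three_mul_inv_sqrt_three_sq
    have v0 : inner ℝ z (regularVertices c u e w 0) = inner ℝ z c - 2 / 3 * w * inner ℝ u z := by
      simp [regularVertices, inner_sub_right, real_inner_smul_right, real_inner_comm z u]
    have v1 : inner ℝ z (regularVertices c u e w 1) = inner ℝ z c + 1 / 3 * w * inner ℝ u z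
        - w * (√3)⁻¹ * inner ℝ e z := by
      simp [regularVertices, inner_sub_right, inner_add_right, real_inner_smul_right,
        real_inner_comm z u, real_inner_comm z e]
    have v2 : inner ℝ z (regularVertices c u e w 2) = inner ℝ z c + 1 / 3 * w * inner ℝ u z
        + w * (√3)⁻¹ * inner ℝ e z := by
      simp [regularVertices, inner_add_right, real_inner_smul_right,
        real_inner_comm z u, real_inner_comm z e]
    have a01 := hsub 0 1
    have a02 := hsub 0 2
    have a12 := hsub 1 2
    have a10 := hsub 1 0
    have a20 := hsub 2 0
    have a21 := hsub 2 1
    rw [v0, v1] at a01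
    rw [v0, v2] at a02
    rw [v1, v2] at a12
    rw [v1, v0] at a10
    rw [v2, v0] at a20
    rw [v2, v1] at a21
    set k : ℝ := (√3)⁻¹
    obtain ⟨p, hp⟩ : ∃ p, p = w * inner ℝ u z := ⟨_, rfl⟩
    obtain ⟨q, hq⟩ : ∃ q, q = w * k * inner ℝ e z := ⟨_, rfl⟩
    have hpq : p ^ 2 + 3 * q ^ 2 = w ^ 2 := by
      rw [hp, hq]
      linear_combination (w ^ 2 * inner ℝ e z ^ 2) * h3 - w ^ 2 * hz2
    have hD : |2 * q| ≤ D ∧ |p - q| ≤ D ∧ |p + q| ≤ D := by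
      refine ⟨abs_le.2 ⟨?_, ?_⟩, abs_le.2 ⟨?_, ?_⟩, abs_le.2 ⟨?_, ?_⟩⟩ <;> linarith
    have hD0 : 0 ≤ D := (abs_nonneg _).trans hD.1
    by_contra! hcon
    have hsq : D ^ 2 < w ^ 2 := by gcongr
    have := sq_add_three_mul_sq_le hD.1 hD.2.1 hD.2.2
    linarith

end Frame

/-! ### Weights and barycentric coordinates -/

/-- The weighted depths `l j * (r - ⟪u j, x⟫)` are nonnegative with sum `r`, so none exceeds `r`. -/
theorem weight_mul_le {u : Fin 3 → Plane} {l : Fin 3 → ℝ} {r w : ℝ} {x : Plane}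
    (hl : ∀ i, 0 ≤ l i) (hs : ∑ i, l i = 1) (h0 : ∑ i, l i • u i = 0)
    (hx : ∀ i, inner ℝ (u i) x ≤ r) {i : Fin 3} (hi : inner ℝ (u i) x ≤ r - w) :
    l i * w ≤ r := by
  have h1 : ∑ j, l j * inner ℝ (u j) x = 0 := by
    have := congrArg (fun y => inner ℝ y x) h0
    simpa [sum_inner, real_inner_smul_left] using this
  have h2 : ∑ j, l j * (r - inner ℝ (u j) x) = r := by
    simp only [mul_sub, Finset.sum_sub_distrib, h1, ← Finset.sum_mul, hs]; ring
  have h3 : l i * (r - inner ℝ (u i) x) ≤ ∑ j, l j * (r - inner ℝ (u j) x) :=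
    Finset.single_le_sum (f := fun j => l j * (r - inner ℝ (u j) x))
      (fun j _ => mul_nonneg (hl j) (by linarith [hx j])) (Finset.mem_univ i)
  have h4 : l i * w ≤ l i * (r - inner ℝ (u i) x) :=
    mul_le_mul_of_nonneg_left (by linarith) (hl i)
  linarith

/-- The barycentric coordinates in the triangle `⟪uᵢ, x⟫ ≤ r`, where `∑ lᵢ uᵢ = 0`. -/
noncomputable def baryWeight (u : Fin 3 → Plane) (l : Fin 3 → ℝ) (r : ℝ) (x : Plane)
    (i : Fin 3) : ℝ :=
  l i * (1 - inner ℝ (u i) x / r)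

section

variable {u : Fin 3 → Plane} {l : Fin 3 → ℝ} {r w d : ℝ} {c e x : Plane}

theorem sum_baryWeight (hs : ∑ i, l i = 1) (h0 : ∑ i, l i • u i = 0) :
    ∑ i, baryWeight u l r x i = 1 := by
  have h1 : ∑ j, l j * inner ℝ (u j) x = 0 := by
    have := congrArg (fun y => inner ℝ y x) h0
    simpa [sum_inner, real_inner_smul_left] using this
  simp only [baryWeight, mul_sub, mul_one, ← mul_div_assoc, Finset.sum_sub_distrib, hs,
    ← Finset.sum_div, h1]
  simp

theorem baryWeight_nonneg (hr : 0 < r) (hl : ∀ i, 0 ≤ l i) {i : Fin 3}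
    (hx : inner ℝ (u i) x ≤ r) : 0 ≤ baryWeight u l r x i :=
  mul_nonneg (hl i) (by rw [sub_nonneg, div_le_one hr]; exact hx)

theorem dist_sum_regularVertices_le (hu : ∀ i, ‖u i‖ = 1) (he : ‖e‖ = 1)
    (hue : inner ℝ (u 0) e = 0)
    (hf : ∀ x y : Plane,
      inner ℝ x y = inner ℝ (u 0) x * inner ℝ (u 0) y + inner ℝ e x * inner ℝ e y)
    (hpos : 0 ≤ inner ℝ e (u 1)) (hw : 0 < w) (hd : 0 ≤ d) (hd' : d ≤ 1 / 150)
    (hr : r = w * (1 / 3 + d)) (hl : ∀ i, l i ≤ 1 / 3 + d) (hl0 : ∀ i, 0 ≤ l i)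
    (hs : ∑ i, l i = 1) (h0 : ∑ i, l i • u i = 0) (hx : ∀ i, inner ℝ (u i) (x - c) ≤ r) :
    dist x (∑ i, baryWeight u l r (x - c) i • regularVertices c (u 0) e w i) ≤
      14.4 * d * w := by
  have hr0 : 0 < r := by rw [hr]; positivity
  have hsa := sum_baryWeight (r := r) (x := x - c) hs h0
  have ha : ∀ i, 0 ≤ baryWeight u l r (x - c) i := fun i => baryWeight_nonneg hr0 hl0 (hx i)
  have hae : ∀ i, (1 / 3 + d) * baryWeight u l r (x - c) i =
      l i * (1 / 3 + d - (inner ℝ (u 0) (u i) * (inner ℝ (u 0) (x - c) / w)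
        + inner ℝ e (u i) * (inner ℝ e (x - c) / w))) := by
    intro i
    rw [baryWeight, hf (u i) (x - c), hr]
    have : 1 / 3 + d ≠ 0 := by positivity
    field_simp
  have hcomp : ∀ v : Plane, l 0 * inner ℝ v (u 0) + l 1 * inner ℝ v (u 1)
      + l 2 * inner ℝ v (u 2) = 0 := by
    intro v
    have := congrArg (fun y => inner ℝ v y) h0
    simpa [Fin.sum_univ_three, inner_add_right, real_inner_smul_right] using this
  have hnorm : ∀ i, inner ℝ (u 0) (u i) ^ 2 + inner ℝ e (u i) ^ 2 = 1 := by
    intro i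
    rw [← norm_sq_eq_of_frame hf, hu, one_pow]
  have h00 : inner ℝ (u 0) (u 0) = (1 : ℝ) := by
    rw [real_inner_self_eq_norm_sq, hu, one_pow]
  have he0 : inner ℝ e (u 0) = (0 : ℝ) := by rw [real_inner_comm]; exact hue
  have hae0 := hae 0
  rw [h00, he0, one_mul, zero_mul, add_zero] at hae0
  have hc0 := hcomp (u 0)
  rw [h00, mul_one] at hc0
  have hce := hcomp e
  rw [he0, mul_zero, zero_add] at hce
  rw [Fin.sum_univ_three] at hs hsa
  have main := displacement_sq_le hd hd' (hl 0) (hl 1) (hl 2) hs (hnorm 1) (hnorm 2) hc0 hce hpos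
    hae0 (hae 1) (hae 2) (ha 0) (ha 1) (ha 2) hsa (by positivity) three_mul_inv_sqrt_three_sq
  have hc : x - ∑ i, baryWeight u l r (x - c) i • regularVertices c (u 0) e w i =
      (x - c) - ((w * (1 / 3 - baryWeight u l r (x - c) 0)) • u 0 +
        (w * ((√3)⁻¹ * (baryWeight u l r (x - c) 2 - baryWeight u l r (x - c) 1))) • e) := by
    rw [Fin.sum_univ_three]
    have : baryWeight u l r (x - c) 0 =
      1 - baryWeight u l r (x - c) 1 - baryWeight u l r (x - c) 2 := by linarith
    rw [this]
    simp only [regularVertices]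
    simp
    module
  obtain ⟨g1, g2⟩ := inner_frame_combination (hu 0) he hue
    (w * (1 / 3 - baryWeight u l r (x - c) 0))
    (w * ((√3)⁻¹ * (baryWeight u l r (x - c) 2 - baryWeight u l r (x - c) 1)))
  rw [dist_eq_norm, hc]
  refine (sq_le_sq₀ (norm_nonneg _) (by positivity)).1 ?_
  rw [norm_sq_eq_of_frame hf, inner_sub_right (u 0), inner_sub_right e, g1, g2]
  have := mul_le_mul_of_nonneg_left main (sq_nonneg w)
  refine le_trans (le_of_eq ?_) (this.trans (le_of_eq (by ring)))
  field_simp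

theorem dist_sum_vertices_le {E : Fin 3 → Plane} {a : Fin 3 → ℝ} {D : ℝ} (ha : ∀ i, 0 ≤ a i)
    (hs : ∑ i, a i = 1) (hE : ∀ i j, i ≠ j → dist (E i) (E j) ≤ D) (i : Fin 3) :
    dist (∑ j, a j • E j) (E i) ≤ (1 - a i) * D := by
  have h1 : ∑ j, a j • E j - E i = ∑ j, a j • (E j - E i) := by
    simp only [smul_sub, Finset.sum_sub_distrib, ← Finset.sum_smul, hs, one_smul]
  have h2 : (1 - a i) = ∑ j ∈ Finset.univ.erase i, a j := by
    rw [← hs, ← Finset.add_sum_erase _ _ (Finset.mem_univ i)]; ring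
  rw [dist_eq_norm, h1, ← Finset.add_sum_erase _ _ (Finset.mem_univ i), h2, Finset.sum_mul]
  simp only [sub_self, smul_zero, zero_add]
  refine (norm_sum_le _ _).trans (Finset.sum_le_sum fun j hj => ?_)
  rw [norm_smul, Real.norm_of_nonneg (ha j), ← dist_eq_norm]
  exact mul_le_mul_of_nonneg_left (hE j i (Finset.ne_of_mem_erase hj)) (ha j)

end

/-! ### Hausdorff distance to the regular triangle -/

theorem alphaE_le {A E : Set Plane} {b : ℝ} (hA : 0 < minWidth A) (hE : IsEquilateralTriangle E)
    (hw : minWidth E = minWidth A) (hd : Metric.hausdorffDist A E ≤ b * minWidth A) :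
    alphaE A ≤ b := by
  refine le_trans (b := Metric.hausdorffDist A E / minWidth E)
    (csInf_le ?_ ⟨E, hE, hw, rfl⟩) ?_
  · refine ⟨0, ?_⟩
    rintro _ ⟨F, -, hF, rfl⟩
    rw [hF]
    exact div_nonneg Metric.hausdorffDist_nonneg hA.le
  · rw [hw]
    exact (div_le_iff₀ hA).2 hd

/-- A convex body whose inscribed disk has radius close to a third of the minimal width is close
to a regular triangle. -/
theorem alphaE_le_of_contactNormals {A : Set Plane} (hA : IsCompact A) (hconv : Convex ℝ A)
    (hne : A.Nonempty) {c : Plane} {r d : ℝ} {u : Fin 3 → Plane} {l : Fin 3 → ℝ}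
    (hw : 0 < minWidth A) (hu : ∀ i, u i ∈ contactNormals A c r) (hl : ∀ i, 0 ≤ l i)
    (hs : ∑ i, l i = 1) (h0 : ∑ i, l i • u i = 0) (hr : r = minWidth A * (1 / 3 + d))
    (hd' : d ≤ 1 / 150) : alphaE A ≤ 25 * d := by
  set w := minWidth A
  have hdeep : ∀ i, ∃ p ∈ A, inner ℝ (u i) (p - c) ≤ r - w :=
    fun i => exists_mem_inner_le_sub_minWidth hA hne (hu i).1 (hu i).2
  choose p hpA hp using hdeep
  have hlw : ∀ i, l i ≤ 1 / 3 + d := fun i => by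
    have := weight_mul_le hl hs h0 (fun j => (hu j).2 _ (hpA i)) (hp i)
    rw [hr, mul_comm] at this
    exact le_of_mul_le_mul_left this hw
  have hd : 0 ≤ d := by
    have h := Finset.sum_le_sum fun i (_ : i ∈ Finset.univ) => hlw i
    rw [hs] at h
    simp at h
    linarith
  have hr0 : 0 < r := by rw [hr]; positivity
  obtain ⟨e, hpos, hue, he, hf⟩ := exists_isometric_frame (v := u 1) (hu 0).1
  have hdist : ∀ x ∈ A, dist x (∑ i, baryWeight u l r (x - c) i • regularVertices c (u 0) e w i) ≤
      14.4 * d * w := fun x hx =>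
    dist_sum_regularVertices_le (fun i => (hu i).1) he hue hf hpos hw hd hd' hr hlw hl hs h0
      fun i => (hu i).2 x hx
  have hnonneg : ∀ x ∈ A, ∀ i, 0 ≤ baryWeight u l r (x - c) i := fun x hx i =>
    baryWeight_nonneg hr0 hl ((hu i).2 x hx)
  have hbound : 0 ≤ 25 * d * w := by positivity
  refine alphaE_le (E := convexHull ℝ (Set.range (regularVertices c (u 0) e w))) hw
    (isEquilateralTriangle_regularVertices (hu 0).1 he hue hw)
    (minWidth_regularVertices (hu 0).1 hue hf hw)
    (Metric.hausdorffDist_le_of_infDist hbound (fun x hx => ?_) fun y hy => ?_)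
  · refine (Metric.infDist_le_dist_of_mem (y := ∑ i, baryWeight u l r (x - c) i •
      regularVertices c (u 0) e w i) ?_).trans ((hdist x hx).trans ?_)
    · exact (convex_convexHull ℝ _).sum_mem (fun i _ => hnonneg x hx i) (sum_baryWeight hs h0)
        fun i _ => subset_convexHull ℝ _ ⟨i, rfl⟩
    · gcongr; norm_num
  -- A closed neighbourhood of a convex set is convex, so only the vertices need to be near `A`.
  · have hvert : Set.range (regularVertices c (u 0) e w) ⊆ Metric.cthickening (25 * d * w) A := by
      rintro _ ⟨i, rfl⟩
      refine Metric.mem_cthickening_of_dist_le _ (p i) _ _ (hpA i) ?_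
      rw [dist_comm]
      have h1 := hdist _ (hpA i)
      have h2 := dist_sum_vertices_le (hnonneg _ (hpA i)) (sum_baryWeight hs h0)
        (fun j k hjk => (dist_regularVertices (c := c) (hu 0).1 he hue hw.le hjk).le) i
      -- Depth `w` makes this coordinate at least `(1/3 - 2d) / (1/3 + d)`, which is at least `1 -
      -- 9d`.
      have h3 : 1 - baryWeight u l r (p i - c) i ≤ 9 * d := by
        have hli : 1 / 3 - 2 * d ≤ l i := by
          have := hlw 0; have := hlw 1; have := hlw 2
          rw [Fin.sum_univ_three] at hs
          fin_cases i <;> simp <;> linarith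
        have hb : l i * w ≤ baryWeight u l r (p i - c) i * r := by
          have : baryWeight u l r (p i - c) i * r = l i * (r - inner ℝ (u i) (p i - c)) := by
            rw [baryWeight]; field_simp
          rw [this]
          exact mul_le_mul_of_nonneg_left (by linarith [hp i]) (hl i)
        have hb' : l i ≤ baryWeight u l r (p i - c) i * (1 / 3 + d) := by
          refine le_of_mul_le_mul_right (hb.trans (le_of_eq ?_)) hw
          rw [hr]; ring
        by_contra! hcon
        nlinarith
      have h4 : (√3 : ℝ)⁻¹ ≤ 0.5775 := by
        have h3 := three_mul_inv_sqrt_three_sq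
        by_contra! hcon
        nlinarith
      have h5 : (1 - baryWeight u l r (p i - c) i) * (2 * w * (√3)⁻¹) ≤
          9 * d * (2 * w * 0.5775) := by gcongr
      have h6 := dist_triangle (p i)
        (∑ j, baryWeight u l r (p i - c) j • regularVertices c (u 0) e w j)
        (regularVertices c (u 0) e w i)
      have h7 : 0 ≤ d * w := by positivity
      -- The total is `14.4 + 18 * 0.5775 = 24.795 < 25`.
      linarith
    have hy' := convexHull_min hvert (hconv.cthickening _) hy
    rwa [Metric.mem_cthickening_iff, ENNReal.le_ofReal_iff_toReal_le
      (Metric.infEDist_ne_top hne) hbound] at hy'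

/-- Mathlib's `ConvexBody` is a nonempty compact convex set; a planar convex body has in addition
nonempty interior. -/
theorem theorem4 (K : ConvexBody Plane) (hK : (interior (K : Set Plane)).Nonempty) :
    inradius (K : Set Plane) / minWidth (K : Set Plane) - 1 / 3
      ≥ (1 / 25 : ℝ) * betaE (K : Set Plane) := by
  obtain ⟨hr, ⟨c, hsub⟩, hmax⟩ := exists_closedBall_inradius_subset K.isCompact hK
  have hw : 0 < minWidth (K : Set Plane) := by
    linarith [two_mul_le_minWidth K.isCompact hr.le hsub]
  obtain ⟨u₁, h₁, u₂, h₂, u₃, h₃, l₁, l₂, l₃, g₁, g₂, g₃, hs, h0⟩ := exists_three_of_mem_convexHull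
    (zero_mem_convexHull_contactNormals K.isCompact K.convex hr hsub hmax)
  have hβ₁ : betaE (K : Set Plane) ≤ alphaE (K : Set Plane) := min_le_left _ _
  have hβ₂ : betaE (K : Set Plane) ≤ 1 / 6 := min_le_right _ _
  -- The threshold is `1/150 = (1/25) * (1/6)`, where the truncation takes over.
  rcases le_total (inradius (K : Set Plane) / minWidth (K : Set Plane) - 1 / 3) (1 / 150)
    with hd | hd
  · have := alphaE_le_of_contactNormals (c := c) (r := inradius (K : Set Plane))
      (u := ![u₁, u₂, u₃]) (l := ![l₁, l₂, l₃]) K.isCompact K.convex K.nonempty hw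
      (fun i => by fin_cases i <;> simpa) (fun i => by fin_cases i <;> simpa)
      (by simpa [Fin.sum_univ_three]) (by simpa [Fin.sum_univ_three])
      (by field_simp; ring) hd
    linarith
  · linarith
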